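/- All graphs are finite, simple and undirected. A graph $G$ is vertex-transitive if for all vertices $u,v$ some automorphism of $G$ takes $u$ to $v$, and arc-transitive if for any two ordered pairs $(u,v)$, $(u',v')$ of adjacent vertices some automorphism of $G$ takes $u$ to $u'$ and $v$ to $v'$. The 2-dimensional Weisfeiler–Leman algorithm (2-WL), run on a graph $G$ with vertex set $V$, computes colorings $\alpha^0,\alpha^1,\alpha^2,\dots$ of $V^2$. The initial color $\alpha^0(u,v)$ is one of three values: "edge" if $u$ and $v$ are adjacent, "nonedge" if $u\neq v$ are non-adjacent, and "loop" if $u=v$. For $r\ge 0$, $$\alpha^{r+1}(u,v)=\{\!\!\{\,(\alpha^{r}(u,w),\,\alpha^{r}(w,v)) : w\in V\,\}\!\!\},$$ where $\{\!\!\{\cdot\}\!\!\}$ denotes a multiset. The partition of $V^2$ into the color classes of $\alpha^{r+1}$ is finer than or equal to that of $\alpha^r$. The output of the algorithm is the coloring $\alpha^t$, where $t$ is the least number such that $\alpha^{t+1}$ and $\alpha^t$ determine the same partition of $V^2$. We say that 2-WL does not split the adjacency relation of $G$ if $\alpha^t(u,v)$ is the same for all ordered pairs $(u,v)$ of adjacent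 vertices. **Theorem.** Let $G$ be a vertex-transitive graph whose number of vertices is prime. Then $G$ is arc-transitive if and only if 2-WL does not split the adjacency relation of $G$. -/

import Mathlib

namespace WL2

/-- The three possible types of an ordered pair of vertices. -/
inductive PairType where
  | edge
  | nonedge
  | loop

/-- The type of the colors used in round `r`: in round `0` a color is a triple
`(type, c u, c v)`, and in each later round it is a multiset of pairs of colors of the
preceding round. -/
def Color (C : Type*) : ℕ → Type _
  | 0 => PairType × C × C
  | r + 1 => Multiset (Color C r × Color C r)

open Classical in
/-- The type of the ordered pair `(u, v)` in the graph `G`. -/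
noncomputable def pairType {V : Type*} (G : SimpleGraph V) (u v : V) : PairType :=
  if u = v then PairType.loop else if G.Adj u v then PairType.edge else PairType.nonedge

/-- The coloring of `V × V` computed by the 2-dimensional Weisfeiler-Leman algorithm in round `r`
on the graph `G` endowed with the vertex coloring `c`. -/
noncomputable def coloring {V C : Type*} [Fintype V] (G : SimpleGraph V) (c : V → C) :
    (r : ℕ) → V → V → Color C r
  | 0, u, v => (pairType G u v, c u, c v)
  | r + 1, u, v =>
      (Finset.univ : Finset V).val.map fun w => (coloring G c r u w, coloring G c r w v)

/-- The partition of `V × V` into the color classes of round `r`. -/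
noncomputable def partition {V C : Type*} [Fintype V] (G : SimpleGraph V) (c : V → C) (r : ℕ) :
    Setoid (V × V) :=
  Setoid.ker fun x : V × V => coloring G c r x.1 x.2

theorem coloring_succ_eq {V C : Type*} [Fintype V] (G : SimpleGraph V) (c : V → C) (r : ℕ)
    (hloop : ∀ u v u' v', coloring G c r u v = coloring G c r u' v' → u = v → u' = v')
    (u v u' v' : V) (h : coloring G c (r + 1) u v = coloring G c (r + 1) u' v') :
    coloring G c r u v = coloring G c r u' v' := by
  have hmem : (coloring G c r u u, coloring G c r u v) ∈
      (Finset.univ : Finset V).val.map fun w => (coloring G c r u w, coloring G c r w v) :=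
    Multiset.mem_map.2 ⟨u, Finset.mem_univ u, rfl⟩
  have h2 : ((Finset.univ : Finset V).val.map fun w =>
      (coloring G c r u w, coloring G c r w v)) =
      (Finset.univ : Finset V).val.map fun w =>
      (coloring G c r u' w, coloring G c r w v') := h
  rw [h2] at hmem
  obtain ⟨w, -, hw⟩ := Multiset.mem_map.1 hmem
  have h3 := (Prod.mk.inj hw).1
  have h4 := (Prod.mk.inj hw).2
  have hw' : u' = w := hloop _ _ _ _ h3.symm rfl
  subst hw'
  exact h4.symm

theorem coloring_loop {V C : Type*} [Fintype V] (G : SimpleGraph V) (c : V → C) (r : ℕ) :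
    ∀ u v u' v', coloring G c r u v = coloring G c r u' v' → u = v → u' = v' := by
  induction r with
  | zero =>
    intro u v u' v' h huv
    have h1 : pairType G u v = pairType G u' v' := congrArg Prod.fst h
    by_contra hne
    unfold pairType at h1
    rw [if_pos huv, if_neg hne] at h1
    split_ifs at h1
  | succ r ih =>
    intro u v u' v' h huv
    exact ih u v u' v' (coloring_succ_eq G c r ih u v u' v' h) huv

/-- Each partition refines the preceding one. -/
theorem partition_succ_le {V C : Type*} [Fintype V] (G : SimpleGraph V) (c : V → C) (r : ℕ) :
    partition G c (r + 1) ≤ partition G c r :=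
  fun _ _ h => coloring_succ_eq G c r (coloring_loop G c r) _ _ _ _ h

/-- The sequence of partitions stabilizes. -/
theorem exists_stable {V C : Type*} [Fintype V] (G : SimpleGraph V) (c : V → C) :
    ∃ t, partition G c (t + 1) = partition G c t := by
  have : Finite (Setoid (V × V)) :=
    Finite.of_injective (fun s : Setoid (V × V) => fun x y => s x y)
      (fun s t h => Setoid.ext fun x y => iff_of_eq (congrFun (congrFun h x) y))
  by_contra hne
  have hlt : StrictAnti (partition G c) :=
    strictAnti_nat_of_succ_lt fun r =>
      lt_of_le_of_ne (partition_succ_le G c r) fun h => hne ⟨r, h⟩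
  exact not_injective_infinite_finite _ hlt.injective

open Classical in
/-- The round in which the algorithm terminates: the first `t` for which the partition of
round `t + 1` is the same as that of round `t`. -/
noncomputable def stopRound {V C : Type*} [Fintype V] (G : SimpleGraph V) (c : V → C) : ℕ :=
  Nat.find (exists_stable G c)

/-- The output of the 2-dimensional Weisfeiler-Leman algorithm on a vertex-colored graph. -/
noncomputable def stableColoring {V C : Type*} [Fintype V] (G : SimpleGraph V) (c : V → C) :
    V → V → Color C (stopRound G c) :=
  coloring G c (stopRound G c)

/-- The output of the 2-dimensional Weisfeiler-Leman algorithm on an uncolored graph,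
that is, a graph all of whose vertices have the same color. -/
noncomputable def output {V : Type*} [Fintype V] (G : SimpleGraph V) :
    V → V → Color Unit (stopRound G fun _ => ()) :=
  stableColoring G fun _ => ()

/-- 2-WL does not split the adjacency relation of `G`: all ordered pairs of adjacent vertices
receive the same color. -/
def NotSplitAdj {V : Type*} [Fintype V] (G : SimpleGraph V) : Prop :=
  ∀ u v u' v' : V, G.Adj u v → G.Adj u' v' → output G u v = output G u' v'

end WL2

/-- Every vertex can be taken to any other vertex by an automorphism. -/
def VertexTransitive {V : Type*} (G : SimpleGraph V) : Prop :=
  ∀ u v : V, ∃ φ : G ≃g G, φ u = v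

/-- Every ordered pair of adjacent vertices can be taken to any other ordered pair of adjacent
vertices by an automorphism. -/
def ArcTransitive {V : Type*} (G : SimpleGraph V) : Prop :=
  ∀ u v u' v' : V, G.Adj u v → G.Adj u' v' → ∃ φ : G ≃g G, φ u = u' ∧ φ v = v'

/-!
A vertex-transitive graph on a prime number `p` of vertices has an automorphism of order `p`, which
permutes the vertices in a single cycle; so the graph is the Cayley graph of a set `S ⊆ ℤ/p`
(`exists_equiv_zmod`).

The content of the theorem is that 2-WL sees enough of `S`. The stable color of `(u, v)` determines
every entry `(A ^ k) u v` of every power of the adjacency matrix `A`, over any semiring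
(`WL2.adjMatrix_pow_eq`). Over `ℤ/q` with `q` prime, `A ^ q` is easily computed: `A` corresponds to
the element `∑ s ∈ S, [s]` of the group algebra of `ℤ/p`, whose `q`-th power is `∑ s ∈ S, [q s]` by
the Frobenius identity. Hence for `q ≠ p` the entry of `A ^ q` at `(a, b)` is `1` if `b - a ∈ q S`
and `0` otherwise (`adjMatrix_pow_prime_apply`). If all arcs have the same stable color, then either
all elements of `S` or none of them lie in `q S`.

Given `s, s' ∈ S`, necessarily nonzero, Dirichlet's theorem provides a prime `q` with
`q = s' / s` in `ℤ/p`; it differs from `p` because `s' / s ≠ 0`. Then `s' ∈ S ∩ q S`, so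
`S ⊆ q S`, and equality holds because the two sets have the same size. Multiplication by `q` is
therefore an automorphism of the graph that fixes `0` and takes `s` to `s'`; together with the
translations this yields arc-transitivity (`arcTransitive_of_notSplitAdj`). This is Schur's theorem
on multipliers, reduced to the single color class that is needed.

Conversely, automorphisms preserve all the colorings computed by 2-WL.
-/

open Finset

/-! ### The stable coloring -/

namespace WL2

theorem adj_iff_of_pairType_eq {V : Type*} {G : SimpleGraph V} {u v u' v' : V}
    (h : pairType G u v = pairType G u' v') : G.Adj u v ↔ G.Adj u' v' := by
  have key : ∀ x y, G.Adj x y ↔ pairType G x y = PairType.edge := by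
    intro x y
    unfold pairType
    split_ifs with h₁ h₂ <;> simp_all
  rw [key, key, h]

variable {V C : Type*} [Fintype V]

theorem coloring_apply_iso (G : SimpleGraph V) (c : V → C) (φ : G ≃g G) (hc : ∀ v, c (φ v) = c v)
    (r : ℕ) (u v : V) : coloring G c r (φ u) (φ v) = coloring G c r u v := by
  classical
  induction r generalizing u v with
  | zero =>
    have h : pairType G (φ u) (φ v) = pairType G u v :=
      if_congr φ.injective.eq_iff rfl (if_congr φ.map_adj_iff rfl rfl)
    exact Prod.ext h (Prod.ext (hc u) (hc v))
  | succ r ih =>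
    change univ.val.map (fun w => (coloring G c r (φ u) w, coloring G c r w (φ v))) =
      univ.val.map fun w => (coloring G c r u w, coloring G c r w v)
    conv_lhs => rw [← Multiset.map_univ_val_equiv φ.toEquiv, Multiset.map_map]
    exact Multiset.map_congr rfl fun w _ => Prod.ext (ih u w) (ih w v)

theorem pairType_eq_of_coloring_eq (G : SimpleGraph V) (c : V → C) {r : ℕ} {u v u' v' : V}
    (h : coloring G c r u v = coloring G c r u' v') : pairType G u v = pairType G u' v' := by
  induction r with
  | zero => exact congrArg Prod.fst h
  | succ r ih => exact ih (coloring_succ_eq G c r (coloring_loop G c r) _ _ _ _ h)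

/-- The stable color of a pair determines the multiset of color pairs seen through all third
vertices, because one more round does not refine the partition. -/
theorem coloring_stopRound_succ (G : SimpleGraph V) (c : V → C) {u v u' v' : V}
    (h : stableColoring G c u v = stableColoring G c u' v') :
    coloring G c (stopRound G c + 1) u v = coloring G c (stopRound G c + 1) u' v' := by
  classical
  have hst : partition G c (stopRound G c + 1) = partition G c (stopRound G c) := by
    unfold stopRound
    exact Nat.find_spec (exists_stable G c)
  have h₁ : partition G c (stopRound G c) (u, v) (u', v') := h
  rw [← hst] at h₁
  exact h₁

/-- The stable color of `(u, v)` determines the weighted number of walks of each length from `u`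
to `v`. -/
theorem adjMatrix_pow_eq [DecidableEq V] (R : Type*) [Semiring R] (G : SimpleGraph V)
    [DecidableRel G.Adj] (c : V → C) (k : ℕ) {u v u' v' : V}
    (h : stableColoring G c u v = stableColoring G c u' v') :
    (G.adjMatrix R ^ k) u v = (G.adjMatrix R ^ k) u' v' := by
  induction k generalizing u v u' v' with
  | zero =>
    have h₁ : u = v ↔ u' = v' :=
      ⟨coloring_loop G c _ _ _ _ _ h, coloring_loop G c _ _ _ _ _ h.symm⟩
    simp [Matrix.one_apply, h₁]
  | succ k ih =>
    rw [pow_succ, Matrix.mul_apply, Matrix.mul_apply]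
    -- The multisets of color pairs agree, and a color pair determines the summand.
    have hrel := Multiset.rel_eq.2 (coloring_stopRound_succ G c h)
    refine congrArg Multiset.sum (Multiset.rel_eq.1 (Multiset.rel_map.2
      ((Multiset.rel_map.1 hrel).mono fun w _ w' _ hw => ?_)))
    have hw₁ := (Prod.mk.inj hw).1
    have hw₂ := adj_iff_of_pairType_eq (pairType_eq_of_coloring_eq G c (Prod.mk.inj hw).2)
    simp only [ih hw₁, SimpleGraph.adjMatrix_apply, hw₂]

end WL2

/-! ### Vertex-transitive graphs of prime order are circulant -/

theorem exists_iso_orderOf_eq_card {V : Type*} [Fintype V] (hp : (Fintype.card V).Prime)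
    (G : SimpleGraph V) (hG : VertexTransitive G) :
    ∃ φ : G ≃g G, orderOf φ = Fintype.card V := by
  classical
  obtain ⟨v₀⟩ : Nonempty V := Fintype.card_pos_iff.1 hp.pos
  have : Fact (Fintype.card V).Prime := ⟨hp⟩
  have : Finite (G ≃g G) := DFunLike.finite _
  let _ : MulAction (G ≃g G) V :=
    { smul φ v := φ v
      one_smul _ := rfl
      mul_smul _ _ _ := rfl }
  have horb : MulAction.orbit (G ≃g G) v₀ = Set.univ := Set.eq_univ_of_forall (hG v₀)
  have hdvd : Fintype.card V ∣ Nat.card (G ≃g G) := by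
    rw [← Nat.card_eq_fintype_card, ← Nat.card_univ (α := V), ← horb,
      Nat.card_congr (MulAction.orbitEquivQuotientStabilizer (G ≃g G) v₀)]
    exact Subgroup.card_quotient_dvd_card _
  exact exists_prime_orderOf_dvd_card' _ hdvd

/-- A vertex-transitive graph of prime order is a Cayley graph of `ℤ/p`: the powers of an
automorphism of order `p` identify the vertices with `ℤ/p`. -/
theorem exists_equiv_zmod {V : Type*} [Fintype V] (hp : (Fintype.card V).Prime)
    (G : SimpleGraph V) (hG : VertexTransitive G) :
    ∃ (e : ZMod (Fintype.card V) ≃ V) (S : Finset (ZMod (Fintype.card V))),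
      ∀ a b, G.Adj (e a) (e b) ↔ b - a ∈ S := by
  classical
  obtain ⟨v₀⟩ : Nonempty V := Fintype.card_pos_iff.1 hp.pos
  have : Fact (Fintype.card V).Prime := ⟨hp⟩
  obtain ⟨φ, hφ⟩ := exists_iso_orderOf_eq_card hp G hG
  set f : ZMod (Fintype.card V) → V := fun a => (φ ^ a.val) v₀ with hf
  have hcast (n : ℕ) : f n = (φ ^ n) v₀ := by
    simp only [hf, ZMod.val_natCast]
    rw [← hφ, pow_mod_orderOf]
  have hadd (a b) : f (a + b) = (φ ^ a.val) (f b) := by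
    have : a + b = ((a.val + b.val : ℕ) : ZMod (Fintype.card V)) := by simp
    rw [this, hcast, pow_add]
    rfl
  let T : (G ≃g G) →* Equiv.Perm V :=
    { toFun ψ := ψ.toEquiv
      map_one' := rfl
      map_mul' _ _ := rfl }
  have hT : Function.Injective T := RelIso.toEquiv_injective
  have hσ : orderOf (T φ) = Fintype.card V := (orderOf_injective T hT φ).trans hφ
  have hcyc : (T φ).IsCycle := Equiv.Perm.isCycle_of_prime_order'' hp hσ
  have hsupp : (T φ).support = univ :=
    Finset.eq_univ_of_card _ (hcyc.orderOf.symm.trans hσ)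
  have hmove (v : V) : T φ v ≠ v := Equiv.Perm.mem_support.1 (hsupp ▸ mem_univ v)
  have hsurj : Function.Surjective f := by
    intro v
    obtain ⟨i, hi⟩ := hcyc.exists_pow_eq (hmove v₀) (hmove v)
    refine ⟨i, ?_⟩
    rw [hcast, ← hi, ← map_pow]
    rfl
  have hbij : Function.Bijective f :=
    (Fintype.bijective_iff_surjective_and_card f).2 ⟨hsurj, ZMod.card _⟩
  refine ⟨Equiv.ofBijective f hbij, univ.filter fun s => G.Adj (f 0) (f s), fun a b => ?_⟩
  have ha := hadd a 0
  have hb := hadd a (b - a)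
  rw [add_zero] at ha
  rw [add_sub_cancel] at hb
  rw [Equiv.ofBijective_apply, Equiv.ofBijective_apply, ha, hb]
  simpa using (φ ^ a.val).map_adj_iff

/-! ### Powers of the adjacency matrix of a circulant graph -/

section Circulant

variable {V : Type*} [Fintype V] [DecidableEq V] {G : SimpleGraph V} [DecidableRel G.Adj]
  {A : Type*} [AddCommGroup A] [Fintype A] [DecidableEq A]
  {e : A ≃ V} {S : Finset A}

open AddMonoidAlgebra in
/-- The powers of the adjacency matrix of the Cayley graph of `S` can be computed in the group
algebra, as the powers of the formal sum of the elements of `S`. -/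
theorem adjMatrix_pow_apply_eq_coeff (R : Type*) [CommSemiring R]
    (h : ∀ a b, G.Adj (e a) (e b) ↔ b - a ∈ S) (k : ℕ) (a b : A) :
    (G.adjMatrix R ^ k) (e a) (e b) =
      ((∑ s ∈ S, single s (1 : R)) ^ k : AddMonoidAlgebra R A).coeff (b - a) := by
  induction k generalizing b with
  | zero =>
    simp [Matrix.one_apply, one_def, Finsupp.single_apply, sub_eq_zero, eq_comm]
  | succ k ih =>
    have hR : ((∑ s ∈ S, single s (1 : R)) ^ (k + 1) : AddMonoidAlgebra R A).coeff (b - a) =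
        ∑ s ∈ S, (G.adjMatrix R ^ k) (e a) (e (b - s)) := by
      rw [pow_succ, mul_sum]
      simp [ih, sub_right_comm, ← sub_eq_add_neg]
    rw [hR, pow_succ, Matrix.mul_apply,
      ← Fintype.sum_equiv ((Equiv.subLeft b).trans e)
        (fun s => (G.adjMatrix R ^ k) (e a) (e (b - s)) * G.adjMatrix R (e (b - s)) (e b)) _
        fun _ => rfl]
    simp [SimpleGraph.adjMatrix_apply, h]

open AddMonoidAlgebra in
/-- Modulo a prime `q`, the `q`-th power of the adjacency matrix of the Cayley graph of `S` is the
matrix of the relation `b - a ∈ q S`, by the Frobenius identity in the group algebra. Injectivity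
of multiplication by `q` ensures that no multiplicities arise. -/
theorem adjMatrix_pow_prime_apply (q : ℕ) [Fact q.Prime]
    (h : ∀ a b, G.Adj (e a) (e b) ↔ b - a ∈ S) (hq : Function.Injective fun a : A => q • a)
    (a b : A) :
    (G.adjMatrix (ZMod q) ^ q) (e a) (e b) = if b - a ∈ S.image (q • ·) then 1 else 0 := by
  have : CharP (AddMonoidAlgebra (ZMod q) A) q := charP_of_injective_algebraMap' (ZMod q) q
  rw [adjMatrix_pow_apply_eq_coeff _ h, sum_pow_char]
  simp only [single_pow, one_pow]
  rw [← sum_image (f := fun t : A => single t (1 : ZMod q)) hq.injOn]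
  simp [Finsupp.single_apply]

end Circulant

/-! ### Multipliers of the connection set -/

/-- If all arcs have the same stable color, then the connection set `S` is mapped to itself by
multiplication by `s' / s` for all `s, s' ∈ S`, so there are enough affine automorphisms. -/
theorem arcTransitive_of_notSplitAdj {V : Type*} [Fintype V] (hp : (Fintype.card V).Prime)
    {G : SimpleGraph V} (hG : VertexTransitive G) (hns : WL2.NotSplitAdj G) :
    ArcTransitive G := by
  classical
  have : Fact (Fintype.card V).Prime := ⟨hp⟩
  obtain ⟨e, S, hS⟩ := exists_equiv_zmod hp G hG
  generalize Fintype.card V = p at *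
  intro u v u' v' huv huv'
  obtain ⟨a, rfl⟩ := e.surjective u
  obtain ⟨b, rfl⟩ := e.surjective v
  obtain ⟨a', rfl⟩ := e.surjective u'
  obtain ⟨b', rfl⟩ := e.surjective v'
  have hs : b - a ≠ 0 := fun h => huv.ne (congrArg e (sub_eq_zero.1 h).symm)
  have hs' : b' - a' ≠ 0 := fun h => huv'.ne (congrArg e (sub_eq_zero.1 h).symm)
  -- As `q` is nonzero modulo the prime `p`, it is a prime other than `p`.
  obtain ⟨q, -, hq, hqm⟩ := Nat.forall_exists_prime_gt_and_eq_mod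
    (div_ne_zero hs' hs).isUnit 0
  have : Fact q.Prime := ⟨hq⟩
  have hq0 : (q : ZMod p) ≠ 0 := hqm ▸ div_ne_zero hs' hs
  have hmul : (q : ZMod p) * (b - a) = b' - a' := by rw [hqm, div_mul_cancel₀ _ hs]
  have hinj : Function.Injective fun x : ZMod p => q • x := by
    simpa only [nsmul_eq_mul] using mul_right_injective₀ hq0
  have hmem : b' - a' ∈ S.image (q • ·) :=
    mem_image.2 ⟨b - a, (hS a b).1 huv, by simpa only [nsmul_eq_mul] using hmul⟩
  have hsub : S ⊆ S.image (q • ·) := by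
    intro s hs
    have hadj : G.Adj (e 0) (e s) := (hS 0 s).2 (by simpa using hs)
    have hcol := WL2.adjMatrix_pow_eq (ZMod q) G (fun _ => ()) q (hns _ _ _ _ hadj huv')
    rw [adjMatrix_pow_prime_apply q hS hinj, adjMatrix_pow_prime_apply q hS hinj, if_pos hmem,
      sub_zero] at hcol
    by_contra hcon
    rw [if_neg hcon] at hcol
    exact zero_ne_one hcol
  have heq : S = S.image (q • ·) := eq_of_subset_of_card_le hsub card_image_le
  have hmulS (x : ZMod p) : (q : ZMod p) * x ∈ S ↔ x ∈ S := by
    have h := hinj.mem_finset_image (s := S) (a := x)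
    rwa [← heq, nsmul_eq_mul] at h
  -- The affine map `x ↦ q (x - a) + a'` takes `a` to `a'` and `b` to `b'`.
  let α : ZMod p ≃ ZMod p :=
    ((Equiv.subRight a).trans (Equiv.mulLeft₀ (q : ZMod p) hq0)).trans (Equiv.addRight a')
  have hα (x) : α x = q * (x - a) + a' := rfl
  refine ⟨⟨(e.symm.trans α).trans e, fun {x y} => ?_⟩, ?_, ?_⟩
  · obtain ⟨x, rfl⟩ := e.surjective x
    obtain ⟨y, rfl⟩ := e.surjective y
    simp only [Equiv.trans_apply, Equiv.symm_apply_apply, hS, hα]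
    rw [add_sub_add_right_eq_sub, ← mul_sub, hmulS, sub_sub_sub_cancel_right]
  · simp [hα]
  · simp [hα, hmul]

theorem notSplitAdj_of_arcTransitive {V : Type*} [Fintype V] {G : SimpleGraph V}
    (hG : ArcTransitive G) : WL2.NotSplitAdj G := by
  intro u v u' v' h h'
  obtain ⟨φ, rfl, rfl⟩ := hG u v u' v' h h'
  exact (WL2.coloring_apply_iso G _ φ (fun _ => rfl) _ u v).symm

theorem theorem3 {V : Type*} [Fintype V] (hp : (Fintype.card V).Prime) (G : SimpleGraph V)
    (hG : VertexTransitive G) :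
    ArcTransitive G ↔ WL2.NotSplitAdj G :=
  ⟨notSplitAdj_of_arcTransitive, arcTransitive_of_notSplitAdj hp hG⟩
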